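/- Let $\mathbb T=\mathbb R/2\pi\mathbb Z$. For $u\in L^2(\mathbb T)$ with Fourier coefficients $\hat u(k)$, $k\in\mathbb Z$, and $t\in\mathbb R$, put $$e^{-it|D|^\alpha}u=\sum_{k\in\mathbb Z}\hat u(k)\,e^{i(kx-|k|^\alpha t)},\qquad \|u\|_{H^\gamma}^2=\sum_{k\in\mathbb Z}(1+k^2)^\gamma|\hat u(k)|^2 .$$ Let $\psi:[0,\infty)\to[0,\infty)$ be any $C^\infty$ function with $\psi>0$ on $[\frac12+\frac1{10},2-\frac1{10}]$, $\psi=0$ outside $(\frac12,2)$ and $\sum_{j\ge1}\psi(2^{-j}x)=1$ for all $x\ge2$. For $N=2^j$ with $j\ge1$ put $$\Delta_Nu=\sum_{k\in\mathbb Z}\psi\!\left(\tfrac{|k|}{N}\right)\hat u(k)e^{ikx},$$ and let $\Delta_1u=u-\sum_{j\ge1}\Delta_{2^j}u$. Let $\frac23<\alpha<1$. Then: (1) There is a constant $C_\alpha>0$, depending only on $\alpha$, such that for every such $\psi$, every $u\in L^2(\mathbb T)$ and every $N=2^j$, $j\ge0$, the function $t\mapsto e^{-it|D|^\alpha}\Delta_Nu$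 belongs to $L^4((0,1),L^\infty(\mathbb T))$ and $$\big\|e^{-it|D|^\alpha}\Delta_Nu\big\|_{L^4((0,1),L^\infty(\mathbb T))}\le C_\alpha\,N^{\frac12-\frac\alpha4}\,\|u\|_{L^2(\mathbb T)} .$$ (2) For every $\gamma>\frac12-\frac\alpha4$ there is a constant $C_{\alpha,\gamma}>0$ such that for every $u\in H^\gamma(\mathbb T)$, the function $t\mapsto e^{-it|D|^\alpha}u$ belongs to $L^4((0,1),L^\infty(\mathbb T))$ and $$\big\|e^{-it|D|^\alpha}u\big\|_{L^4((0,1),L^\infty(\mathbb T))}\le C_{\alpha,\gamma}\,\|u\|_{H^\gamma(\mathbb T)} .$$ -/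

import Mathlib

open MeasureTheory Set
open scoped Real ENNReal ContDiff

noncomputable section

namespace TorusStrichartz

instance fact_two_pi_pos : Fact (0 < 2 * π) := ⟨Real.two_pi_pos⟩

/-- The torus `ℝ / 2πℤ`. -/
abbrev Torus : Type := AddCircle (2 * π)

/-- The measure `dx / 2π` on the torus. -/
abbrev torusMeasure : Measure Torus := AddCircle.haarAddCircle

/-- `L²(𝕋)`, complex valued. -/
abbrev L2Torus : Type := Lp ℂ 2 torusMeasure

/-- `L^∞(𝕋)`, complex valued. -/
abbrev LinfTorus : Type := Lp ℂ ∞ torusMeasure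

/-- The (Bochner) space `L⁴((0,1), L^∞(𝕋))`. -/
abbrev L4Linf : Type := Lp LinfTorus 4 ((volume : Measure ℝ).restrict (Ioo 0 1))

/-- The Fourier multiplier `m(D)` on `L²(𝕋)`: `m(D) u = ∑ₖ m(k) û(k) e^{ikx}`, the series being
summed in `L²(𝕋)`. It converges whenever the symbol `m` is bounded, see `hasSum_fourierMul`. -/
def fourierMul (m : ℤ → ℂ) (u : L2Torus) : L2Torus :=
  ∑' k : ℤ, (m k * fourierCoeff u k) • fourierLp 2 k

theorem hasSum_fourierMul {m : ℤ → ℂ} {B : ℝ} (hm : ∀ k, ‖m k‖ ≤ B) (u : L2Torus) :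
    HasSum (fun k : ℤ => (m k * fourierCoeff u k) • fourierLp 2 k) (fourierMul m u) := by
  have hu : Memℓp (fun k : ℤ => fourierCoeff u k) 2 := by
    have h := lp.memℓp (fourierBasis.repr u)
    have e : (fun k : ℤ => fourierCoeff u k) = ⇑(fourierBasis.repr u) := by
      funext k
      exact (fourierBasis_repr u k).symm
    rw [e]
    exact h
  have hmu : Memℓp (fun k : ℤ => m k * fourierCoeff u k) 2 := by
    have hs := (memℓp_gen_iff (p := (2 : ℝ≥0∞)) (by norm_num)).1 hu
    refine (memℓp_gen_iff (p := (2 : ℝ≥0∞)) (by norm_num)).2 ?_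
    simp only [ENNReal.toReal_ofNat, Real.rpow_ofNat] at hs ⊢
    refine Summable.of_nonneg_of_le (fun k => by positivity) (fun k => ?_) (hs.mul_left (B ^ 2))
    rw [norm_mul, mul_pow]
    have := hm k
    gcongr
  have h := (fourierBasis (T := 2 * π)).hasSum_repr_symm ⟨_, hmu⟩
  simp only [coe_fourierBasis] at h
  exact h.summable.hasSum

/-- The propagator `S(t) = e^{-it|D|^α}`. -/
def propagator (α t : ℝ) (u : L2Torus) : L2Torus :=
  fourierMul (fun k => Complex.exp (-(Complex.I * t * (|(k : ℝ)| ^ α : ℝ)))) u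

/-- The profiles of Littlewood-Paley decompositions. Only the values of `ψ` on `[0, ∞)` matter. -/
structure IsLPProfile (ψ : ℝ → ℝ) : Prop where
  smooth : ContDiffOn ℝ ∞ ψ (Ici 0)
  nonneg : ∀ x, 0 ≤ x → 0 ≤ ψ x
  pos : ∀ x ∈ Icc (1 / 2 + 1 / 10 : ℝ) (2 - 1 / 10), 0 < ψ x
  eq_zero : ∀ x, 0 ≤ x → x ∉ Ioo (1 / 2 : ℝ) 2 → ψ x = 0
  hasSum_one : ∀ x, 2 ≤ x → HasSum (fun j : ℕ => ψ (x / 2 ^ (j + 1))) 1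

/-- The symbol of `Δ_N` for `N = 2 ^ j`: it is `ψ(|k|/N)` if `j ≥ 1`, and
`1 - ∑_{i ≥ 1} ψ(2^{-i}|k|)` if `N = 1`, so that `Δ_1 u = u - ∑_{i ≥ 1} Δ_{2^i} u`. -/
def lpSymbol (ψ : ℝ → ℝ) (j : ℕ) (k : ℤ) : ℝ :=
  if j = 0 then 1 - ∑' i : ℕ, ψ (|(k : ℝ)| / 2 ^ (i + 1)) else ψ (|(k : ℝ)| / 2 ^ j)

/-- The Littlewood-Paley block `Δ_N u`, for `N = 2 ^ j`. -/
def lpBlock (ψ : ℝ → ℝ) (j : ℕ) (u : L2Torus) : L2Torus :=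
  fourierMul (fun k => (lpSymbol ψ j k : ℂ)) u

/-- `u ∈ H^s(𝕋)`, for `u ∈ L²(𝕋)` (hence for all of `H^s(𝕋)` when `s ≥ 0`). -/
def MemSobolev (s : ℝ) (u : L2Torus) : Prop :=
  Summable fun k : ℤ => (1 + (k : ℝ) ^ 2) ^ s * ‖fourierCoeff u k‖ ^ 2

/-- The norm of `H^s(𝕋)`. -/
def sobolevNorm (s : ℝ) (u : L2Torus) : ℝ :=
  √(∑' k : ℤ, (1 + (k : ℝ) ^ 2) ^ s * ‖fourierCoeff u k‖ ^ 2)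

/-- The curve `f` with values in `L²(𝕋)`, restricted to `(0,1)`, belongs to `L⁴((0,1), L^∞(𝕋))`,
with norm at most `M`: it coincides almost everywhere with a (necessarily unique) element of that
space, whose norm is at most `M`. -/
def L4LinfNormLE (f : ℝ → L2Torus) (M : ℝ) : Prop :=
  ∃ F : L4Linf, (∀ᵐ t ∂(volume : Measure ℝ).restrict (Ioo 0 1),
    (F t : Torus → ℂ) =ᵐ[torusMeasure] (f t : Torus → ℂ)) ∧ ‖F‖ ≤ M

end TorusStrichartz

end

namespace TorusStrichartz

/-- Summation by parts for a sequence whose terms are `z n = (z (n + 1) - z n) * q n`. -/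
theorem norm_sum_sub_le_of_eq_sub_mul {z q : ℕ → ℂ} {v : ℕ → ℝ} {m : ℕ} (hz : ∀ n, ‖z n‖ ≤ 1)
    (hzq : ∀ n ≤ m, z n = (z (n + 1) - z n) * q n)
    (hq : ∀ n < m, ‖q (n + 1) - q n‖ ≤ v (n + 1) - v n) :
    ‖∑ n ∈ Finset.range (m + 1), z n - z (m + 1) * q m‖ ≤ ‖q 0‖ + (v m - v 0) := by
  induction m with
  | zero =>
    have h : ∑ n ∈ Finset.range (0 + 1), z n - z (0 + 1) * q 0 = -(z 0 * q 0) := by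
      have := hzq 0 le_rfl
      simp only [zero_add, Finset.sum_range_one] at this ⊢
      linear_combination this
    rw [h, norm_neg, norm_mul, sub_self, add_zero]
    exact mul_le_of_le_one_left (norm_nonneg _) (hz 0)
  | succ m ih =>
    have ih := ih (fun n hn => hzq n (by omega)) (fun n hn => hq n (by omega))
    have h : ∑ n ∈ Finset.range (m + 1 + 1), z n - z (m + 1 + 1) * q (m + 1) =
        (∑ n ∈ Finset.range (m + 1), z n - z (m + 1) * q m) -
          z (m + 1) * (q (m + 1) - q m) := by
      rw [Finset.sum_range_succ _ (m + 1)]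
      linear_combination hzq (m + 1) le_rfl
    rw [h]
    have h1 := norm_sub_le (∑ n ∈ Finset.range (m + 1), z n - z (m + 1) * q m)
      (z (m + 1) * (q (m + 1) - q m))
    have h2 : ‖z (m + 1) * (q (m + 1) - q m)‖ ≤ v (m + 1) - v m := by
      rw [norm_mul]
      exact (mul_le_of_le_one_left (norm_nonneg _) (hz _)).trans (hq m (by omega))
    linarith

theorem inv_exp_mul_I_sub_one {θ : ℝ} (hθ : Real.sin (θ / 2) ≠ 0) :
    (Complex.exp (θ * Complex.I) - 1)⁻¹ =
      -(1 / 2) - (Real.cos (θ / 2) / Real.sin (θ / 2) / 2 : ℝ) * Complex.I := by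
  have hs : (Real.sin (θ / 2) : ℂ) ≠ 0 := by exact_mod_cast hθ
  have hp : ((Real.sin (θ / 2) : ℂ)) ^ 2 + (Real.cos (θ / 2) : ℂ) ^ 2 = 1 := by
    exact_mod_cast Real.sin_sq_add_cos_sq (θ / 2)
  have he : Complex.exp (θ * Complex.I) =
      ((Real.cos (θ / 2) : ℂ) + Real.sin (θ / 2) * Complex.I) ^ 2 := by
    rw [Complex.ofReal_cos, Complex.ofReal_sin, ← Complex.exp_mul_I, ← Complex.exp_nat_mul]
    congr 1
    push_cast
    ring
  refine inv_eq_of_mul_eq_one_left ?_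
  rw [he]
  push_cast at hs hp ⊢
  field_simp
  have hI := Complex.I_sq
  set s := Complex.sin (θ / 2)
  set c := Complex.cos (θ / 2)
  linear_combination (s - c * Complex.I) * hp + (-s * s ^ 2 - s ^ 2 * c * Complex.I - 2 * c ^ 2 * s) * hI

theorem le_sin_half {δ θ : ℝ} (h0 : 0 < δ) (h1 : δ ≤ θ) (h2 : θ ≤ 2 * π - δ) :
    δ / π ≤ Real.sin (θ / 2) := by
  have hpi := Real.pi_pos
  rcases le_total (θ / 2) (π / 2) with h | h
  · refine le_trans ?_ (Real.mul_le_sin (by linarith) h)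
    rw [div_mul_div_comm, mul_comm π 2, mul_div_mul_left _ _ two_ne_zero]
    gcongr
  · rw [← Real.sin_pi_sub]
    refine le_trans ?_ (Real.mul_le_sin (by linarith) (by linarith))
    rw [div_mul_eq_mul_div]
    gcongr
    linarith

/-- The Kuzmin-Landau inequality. -/
theorem norm_sum_le_of_antitone_of_mem_Icc {z : ℕ → ℂ} {g : ℕ → ℝ} {δ : ℝ} {m : ℕ} (hδ : 0 < δ)
    (hz : ∀ n, ‖z n‖ ≤ 1) (hzg : ∀ n, z (n + 1) = z n * Complex.exp (g n * Complex.I))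
    (hg : ∀ n, n + 1 < m → g (n + 1) ≤ g n) (hg' : ∀ n < m, g n ∈ Icc δ (2 * π - δ)) :
    ‖∑ n ∈ Finset.range m, z n‖ ≤ 2 * π / δ := by
  have hpi := Real.pi_pos
  obtain _ | m := m
  · simp only [Finset.range_zero, Finset.sum_empty, norm_zero]
    positivity
  have hs : ∀ n ≤ m, δ / π ≤ Real.sin (g n / 2) := fun n hn =>
    le_sin_half hδ (hg' n (by omega)).1 (hg' n (by omega)).2
  have hδpi : 0 < δ / π := by positivity
  have hs0 : ∀ n ≤ m, 0 < Real.sin (g n / 2) := fun n hn => hδpi.trans_le (hs n hn)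
  set q : ℕ → ℂ := fun n => (Complex.exp (g n * Complex.I) - 1)⁻¹ with hq
  set v : ℕ → ℝ := fun n => Real.cos (g n / 2) / Real.sin (g n / 2) / 2 with hv
  have hqv : ∀ n ≤ m, q n = -(1 / 2) - (v n : ℝ) * Complex.I := fun n hn =>
    inv_exp_mul_I_sub_one (hs0 n hn).ne'
  have hne : ∀ n ≤ m, Complex.exp (g n * Complex.I) - 1 ≠ 0 := by
    intro n hn h
    have h1 := hqv n hn
    rw [hq] at h1
    simp only [h, inv_zero] at h1
    have h2 := congrArg Complex.re h1
    norm_num at h2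
  have hinv : ∀ n ≤ m, 1 / (2 * Real.sin (g n / 2)) ≤ π / (2 * δ) := by
    intro n hn
    rw [div_le_div_iff₀ (by have := hs0 n hn; positivity) (by positivity)]
    have := (div_le_iff₀ hpi).1 (hs n hn)
    linarith
  have hqn : ∀ n ≤ m, ‖q n‖ ≤ π / (2 * δ) := by
    intro n hn
    refine le_trans (le_of_eq ?_) (hinv n hn)
    rw [hq]
    simp only
    rw [norm_inv, mul_comm _ Complex.I, Complex.norm_exp_I_mul_ofReal_sub_one, Real.norm_eq_abs,
      abs_of_pos (by have := hs0 n hn; positivity), one_div]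
  have hvn : ∀ n ≤ m, |v n| ≤ π / (2 * δ) := by
    intro n hn
    refine le_trans ?_ (hinv n hn)
    rw [hv]
    simp only
    rw [div_div, abs_div, abs_of_pos (a := Real.sin (g n / 2) * 2) (by have := hs0 n hn; positivity),
      mul_comm _ (2 : ℝ)]
    have := hs0 n hn
    gcongr
    exact Real.abs_cos_le_one _
  have key := norm_sum_sub_le_of_eq_sub_mul (z := z) (q := q) (v := v) (m := m) hz
    (fun n hn => by
      rw [hzg n]
      have := mul_inv_cancel₀ (hne n hn)
      rw [hq]
      simp only
      linear_combination (-z n) * this)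
    (fun n hn => by
      rw [hqv n hn.le, hqv (n + 1) (by omega)]
      have h1 : -(1 / 2 : ℂ) - (v (n + 1) : ℝ) * Complex.I - (-(1 / 2) - (v n : ℝ) * Complex.I) =
          ((-(v (n + 1) - v n) : ℝ) : ℂ) * Complex.I := by
        push_cast
        ring
      rw [h1, norm_mul, Complex.norm_I, mul_one, Complex.norm_real, norm_neg, Real.norm_eq_abs,
        abs_of_nonneg]
      have ha := hs0 n hn.le
      have hb := hs0 (n + 1) (by omega)
      have h2 : v (n + 1) - v n = Real.sin (g n / 2 - g (n + 1) / 2) /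
          (Real.sin (g n / 2) * Real.sin (g (n + 1) / 2)) / 2 := by
        rw [hv, Real.sin_sub]
        simp only
        field_simp
      rw [h2]
      have h3 : 0 ≤ Real.sin (g n / 2 - g (n + 1) / 2) := by
        have h4 := hg n (by omega)
        have h5 := (hg' n (by omega)).2
        have h6 := (hg' (n + 1) (by omega)).1
        exact Real.sin_nonneg_of_nonneg_of_le_pi (by linarith) (by linarith)
      positivity)
  have h1 : ‖∑ n ∈ Finset.range (m + 1), z n‖ ≤
      ‖∑ n ∈ Finset.range (m + 1), z n - z (m + 1) * q m‖ + ‖z (m + 1) * q m‖ := by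
    simpa using norm_add_le (∑ n ∈ Finset.range (m + 1), z n - z (m + 1) * q m) (z (m + 1) * q m)
  have h2 : ‖z (m + 1) * q m‖ ≤ π / (2 * δ) := by
    rw [norm_mul]
    exact (mul_le_of_le_one_left (norm_nonneg _) (hz _)).trans (hqn m le_rfl)
  have h3 := hqn 0 (by omega)
  have h4 := (abs_le.1 (hvn m le_rfl)).2
  have h5 := (abs_le.1 (hvn 0 (by omega))).1
  have h6 : 2 * π / δ = 4 * (π / (2 * δ)) := by
    field_simp
    norm_num
  linarith

theorem exists_isLeast_not {p : ℕ → Prop} (M : ℕ)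
    (hp : ∀ n, n + 1 < M → p (n + 1) → p n) :
    ∃ a ≤ M, (∀ n < a, p n) ∧ ∀ n, a ≤ n → n < M → ¬ p n := by
  classical
  have hex : ∃ a, M ≤ a ∨ ¬ p a := ⟨M, Or.inl le_rfl⟩
  refine ⟨Nat.find hex, Nat.find_min' hex (Or.inl le_rfl), fun n hn => ?_, fun n hn => ?_⟩
  · have := Nat.find_min hex hn
    push Not at this
    exact this.2
  · induction n, hn using Nat.le_induction with
    | base => exact fun h => (Nat.find_spec hex).resolve_left (by omega)
    | succ n hn ih => exact fun h h' => ih (by omega) (hp n h h')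

/-- Van der Corput's second derivative test for exponential sums, in the case where the first
differences `g n` of the phase range over an interval of length `1`. -/
theorem norm_sum_le_of_sub_le {z : ℕ → ℂ} {g : ℕ → ℝ} {y Λ : ℝ} {M : ℕ}
    (hΛ : 0 < Λ) (hΛ1 : Λ ≤ 1)
    (hz : ∀ n, ‖z n‖ ≤ 1) (hzg : ∀ n, z (n + 1) = z n * Complex.exp (g n * Complex.I))
    (hg : ∀ n, n + 1 < M → Λ ≤ g n - g (n + 1)) (hg' : ∀ n < M, g n ∈ Icc (y - 1) y) :
    ‖∑ n ∈ Finset.range M, z n‖ ≤ 16 / √Λ := by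
  wlog hy : y ∈ Ico (1 / 2 - π) (1 / 2 + π) generalizing g y with H
  · obtain ⟨ℓ, hℓ, -⟩ := existsUnique_add_zsmul_mem_Ico Real.two_pi_pos y (1 / 2 - π)
    simp only [zsmul_eq_mul] at hℓ
    refine H (g := fun n => g n + ℓ * (2 * π)) (y := y + ℓ * (2 * π)) (fun n => ?_)
      (fun n hn => ?_) (fun n hn => ?_) ⟨hℓ.1, hℓ.2.trans_eq (by ring)⟩
    · rw [hzg n]
      push_cast
      rw [add_mul, Complex.exp_add]
      have : Complex.exp (ℓ * (2 * π) * Complex.I) = 1 := by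
        rw [mul_assoc]
        exact Complex.exp_int_mul_two_pi_mul_I ℓ
      rw [this, mul_one]
    · have := hg n hn
      linarith
    · have := hg' n hn
      exact ⟨by linarith [this.1], by linarith [this.2]⟩
  have hpi := Real.pi_pos
  have hpi3 := Real.pi_gt_three
  have hpi4 := Real.pi_lt_d2
  set δ := √Λ with hδ
  have hδ0 : 0 < δ := Real.sqrt_pos.2 hΛ
  have hδ1 : δ ≤ 1 := Real.sqrt_le_one.2 hΛ1
  have hδΛ : δ * δ = Λ := Real.mul_self_sqrt hΛ.le
  have hanti : ∀ n, n + 1 < M → g (n + 1) ≤ g n := fun n hn => by linarith [hg n hn]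
  obtain ⟨a, haM, ha1, ha2⟩ := exists_isLeast_not (p := fun n => δ ≤ g n) M
    (fun n hn h => h.trans (hanti n hn))
  obtain ⟨b, hbM, hb1, hb2⟩ := exists_isLeast_not (p := fun n => -δ < g n) M
    (fun n hn h => h.trans_le (hanti n hn))
  have hab : a ≤ b := by
    by_contra! h
    have h1 := ha1 b h
    have h2 := hb2 b le_rfl (by omega)
    linarith
  rw [Finset.range_eq_Ico, ← Finset.sum_Ico_consecutive z (Nat.zero_le a) haM,
    ← Finset.sum_Ico_consecutive z hab hbM]
  have hA : ‖∑ n ∈ Finset.Ico 0 a, z n‖ ≤ 2 * π / δ := by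
    rw [← Finset.range_eq_Ico]
    refine norm_sum_le_of_antitone_of_mem_Icc hδ0 hz hzg (fun n hn => hanti n (by omega))
      (fun n hn => ⟨ha1 n hn, ?_⟩)
    have := (hg' n (by omega)).2
    linarith [hy.2]
  have hC : ‖∑ n ∈ Finset.Ico b M, z n‖ ≤ 2 * π / δ := by
    rw [Finset.sum_Ico_eq_sum_range]
    refine norm_sum_le_of_antitone_of_mem_Icc (g := fun n => g (b + n) + 2 * π) hδ0
      (fun n => hz _) (fun n => ?_) (fun n hn => ?_) (fun n hn => ⟨?_, ?_⟩)
    · rw [← add_assoc, hzg (b + n)]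
      push_cast
      rw [add_mul, Complex.exp_add, Complex.exp_two_pi_mul_I, mul_one]
    · have := hanti (b + n) (by omega)
      rw [← add_assoc]
      linarith
    · have := (hg' (b + n) (by omega)).1
      linarith [hy.1]
    · have := hb2 (b + n) (by omega) (by omega)
      linarith
  have hB : ‖∑ n ∈ Finset.Ico a b, z n‖ ≤ 3 / δ := by
    have h1 : ‖∑ n ∈ Finset.Ico a b, z n‖ ≤ (b - a : ℕ) := by
      refine (norm_sum_le_of_le _ (fun n _ => hz n)).trans ?_
      simp
    refine h1.trans ?_
    rcases hab.eq_or_lt with h | h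
    · rw [h, Nat.sub_self, Nat.cast_zero]
      positivity
    have h2 : ∀ k, a + k < M → Λ * k ≤ g a - g (a + k) := by
      intro k
      induction k with
      | zero => simp
      | succ k ih =>
        intro hk
        have h3 := ih (by omega)
        have h4 := hg (a + k) (by omega)
        push_cast
        rw [← add_assoc]
        linarith
    have h3 := h2 (b - a - 1) (by omega)
    have h4 := ha2 a le_rfl (by omega)
    have h5 := hb1 (b - 1) (by omega)
    rw [show a + (b - a - 1) = b - 1 by omega] at h3
    have h6 : ((b - a : ℕ) : ℝ) = (b - a - 1 : ℕ) + 1 := by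
      rw [← Nat.cast_add_one]
      congr 1
      omega
    rw [h6, le_div_iff₀ hδ0]
    have h7 : δ * (δ * (b - a - 1 : ℕ)) ≤ δ * 2 := by
      rw [← mul_assoc, hδΛ]
      linarith
    have h8 := le_of_mul_le_mul_left h7 hδ0
    linarith
  have h1 := norm_add₃_le (a := ∑ n ∈ Finset.Ico 0 a, z n) (b := ∑ n ∈ Finset.Ico a b, z n)
    (c := ∑ n ∈ Finset.Ico b M, z n)
  rw [add_assoc] at h1
  refine h1.trans ((add_le_add (add_le_add hA hB) hC).trans ?_)
  rw [← add_div, ← add_div]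
  gcongr
  linarith

/-- The second differences of `n ↦ n ^ α`. -/
theorem le_second_difference_rpow {α R x : ℝ} (h0 : 0 < α) (h1 : α < 1) (hx : 0 ≤ x)
    (hxR : x + 2 ≤ R) :
    α * (1 - α) * R ^ (α - 2) ≤
      ((x + 1) ^ α - x ^ α) - ((x + 1 + 1) ^ α - (x + 1) ^ α) := by
  set Λ := α * (1 - α) * R ^ (α - 2) with hΛ
  have hR : 0 < R := by linarith
  have hconc : ConcaveOn ℝ (Icc 0 R) (fun y : ℝ => y ^ α + Λ * y ^ 2 / 2) := by
    have hd : ∀ y : ℝ, 0 < y → HasDerivAt (fun y : ℝ => y ^ α + Λ * y ^ 2 / 2)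
        (α * y ^ (α - 1) + Λ * y) y := by
      intro y hy
      have e := (Real.hasDerivAt_rpow_const (p := α) (Or.inl hy.ne')).add
        (((hasDerivAt_pow 2 y).const_mul Λ).div_const 2)
      refine e.congr_deriv ?_
      simp
      ring
    refine concaveOn_of_hasDerivWithinAt2_nonpos (convex_Icc 0 R) ?_
      (f' := fun y => α * y ^ (α - 1) + Λ * y)
      (f'' := fun y => α * ((α - 1) * y ^ (α - 1 - 1)) + Λ) ?_ ?_ ?_
    · refine ContinuousOn.add ?_ (by fun_prop)
      exact (Real.continuous_rpow_const h0.le).continuousOn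
    · intro y hy
      rw [interior_Icc] at hy
      exact (hd y hy.1).hasDerivWithinAt
    · intro y hy
      rw [interior_Icc] at hy
      have e := ((Real.hasDerivAt_rpow_const (p := α - 1) (Or.inl hy.1.ne')).const_mul α).add
        ((hasDerivAt_id y).const_mul Λ)
      exact (e.congr_deriv (by simp)).hasDerivWithinAt
    · intro y hy
      rw [interior_Icc] at hy
      have e : R ^ (α - 2) ≤ y ^ (α - 2) :=
        Real.rpow_le_rpow_of_nonpos hy.1 hy.2.le (by linarith)
      rw [show α - 1 - 1 = α - 2 by ring, hΛ]
      have : 0 ≤ α * (1 - α) := mul_nonneg h0.le (by linarith)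
      nlinarith [mul_le_mul_of_nonneg_left e this]
  have h : (1 / 2 : ℝ) • _ + (1 / 2 : ℝ) • _ ≤ _ :=
    hconc.2 (⟨hx, by linarith⟩ : x ∈ Icc 0 R) (⟨by linarith, by linarith⟩ : x + 1 + 1 ∈ Icc 0 R)
      (by norm_num) (by norm_num) (by norm_num)
  simp only [smul_eq_mul] at h
  rw [show 1 / 2 * x + 1 / 2 * (x + 1 + 1) = x + 1 by ring] at h
  nlinarith

theorem norm_sum_range_exp_le {α t : ℝ} (h0 : 0 < α) (h1 : α < 1) (ht : 0 < t) (ht1 : t ≤ 1)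
    {R : ℕ} (hR : 1 ≤ R) (x : ℝ) :
    ‖∑ n ∈ Finset.range R, Complex.exp ((n * x + (n : ℝ) ^ α * t : ℝ) * Complex.I)‖ ≤
      16 / √(t * (α * (1 - α) * (R : ℝ) ^ (α - 2))) := by
  have hR' : (1 : ℝ) ≤ R := by exact_mod_cast hR
  have hΛ : 0 < α * (1 - α) * (R : ℝ) ^ (α - 2) :=
    mul_pos (mul_pos h0 (by linarith)) (Real.rpow_pos_of_pos (by linarith) _)
  have hΛ1 : α * (1 - α) * (R : ℝ) ^ (α - 2) ≤ 1 := by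
    refine mul_le_one₀ (by nlinarith) (by positivity) ?_
    exact Real.rpow_le_one_of_one_le_of_nonpos hR' (by linarith)
  refine norm_sum_le_of_sub_le (y := x + 1)
    (g := fun n : ℕ => x + t * (((n : ℝ) + 1) ^ α - (n : ℝ) ^ α)) (mul_pos ht hΛ)
    (mul_le_one₀ ht1 hΛ.le hΛ1) (fun n => ?_) (fun n => ?_) (fun n hn => ?_) (fun n hn => ?_)
  · rw [Complex.norm_exp_ofReal_mul_I]
  · rw [← Complex.exp_add]
    congr 1
    push_cast
    ring
  · have h := le_second_difference_rpow h0 h1 (R := R) (x := n) (Nat.cast_nonneg n)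
      (by exact_mod_cast hn)
    push_cast
    nlinarith
  · have h2 : (n : ℝ) ^ α ≤ ((n : ℝ) + 1) ^ α :=
      Real.rpow_le_rpow (Nat.cast_nonneg n) (by linarith) h0.le
    have h3 : ((n : ℝ) + 1) ^ α ≤ (n : ℝ) ^ α + 1 := by
      simpa using Real.rpow_add_le_add_rpow (Nat.cast_nonneg n) (zero_le_one' ℝ) h0.le h1.le
    constructor <;> nlinarith

theorem sum_Ioo_neg_eq (f : ℤ → ℂ) (R : ℕ) :
    ∑ k ∈ Finset.Ioo (-((R + 1 : ℕ) : ℤ)) (R + 1 : ℕ), f k =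
      ∑ n ∈ Finset.range (R + 1), f n + ∑ n ∈ Finset.range (R + 1), f (-n) - f 0 := by
  induction R with
  | zero =>
    have : Finset.Ioo (-((0 + 1 : ℕ) : ℤ)) (0 + 1 : ℕ) = {0} := by decide
    rw [this]
    simp
  | succ R ih =>
    have : Finset.Ioo (-((R + 1 + 1 : ℕ) : ℤ)) (R + 1 + 1 : ℕ) =
        insert ((R + 1 : ℕ) : ℤ) (insert (-((R + 1 : ℕ) : ℤ))
          (Finset.Ioo (-((R + 1 : ℕ) : ℤ)) (R + 1 : ℕ))) := by
      ext k
      simp only [Finset.mem_Ioo, Finset.mem_insert]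
      omega
    rw [this, Finset.sum_insert, Finset.sum_insert, ih, Finset.sum_range_succ _ (R + 1),
      Finset.sum_range_succ _ (R + 1)]
    · ring
    · simp
    · simp only [Finset.mem_Ioo, Finset.mem_insert]
      omega

/-- The dispersive estimate for the frequency localized propagator. -/
theorem norm_kernel_le {α : ℝ} (h0 : 0 < α) (h1 : α < 1) {t : ℝ} (ht : t ≠ 0) (ht1 : |t| ≤ 1)
    {R : ℕ} (hR : 1 ≤ R) (x : ℝ) :
    ‖∑ k ∈ Finset.Ioo (-(R : ℤ)) R, Complex.exp ((k * x - |(k : ℝ)| ^ α * t : ℝ) * Complex.I)‖ ≤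
      33 / √(α * (1 - α)) * (R : ℝ) ^ (1 - α / 2) * |t| ^ (-(1 / 2) : ℝ) := by
  have hR' : (1 : ℝ) ≤ R := by exact_mod_cast hR
  wlog hneg : t < 0 generalizing t x with H
  · have := H (t := -t) (neg_ne_zero.2 ht) (by rwa [abs_neg]) (-x)
      (by have := lt_of_le_of_ne (not_lt.1 hneg) ht.symm; linarith)
    rw [abs_neg] at this
    refine le_trans (le_of_eq ?_) this
    rw [← Complex.norm_conj, map_sum]
    congr 1
    refine Finset.sum_congr rfl fun k _ => ?_
    rw [← Complex.exp_conj, map_mul, Complex.conj_I, Complex.conj_ofReal]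
    congr 1
    push_cast
    ring
  have ht0 : 0 < |t| := abs_pos.2 ht
  obtain ⟨R, rfl⟩ : ∃ S, R = S + 1 := ⟨R - 1, by omega⟩
  rw [sum_Ioo_neg_eq]
  have hA := norm_sum_range_exp_le h0 h1 ht0 ht1 hR x
  have hB := norm_sum_range_exp_le h0 h1 ht0 ht1 hR (-x)
  set S : ℝ := ((R + 1 : ℕ) : ℝ) with hS
  have hα : 0 < α * (1 - α) := mul_pos h0 (by linarith)
  have hsqrt : 1 / √(|t| * (α * (1 - α) * S ^ (α - 2))) =
      1 / √(α * (1 - α)) * S ^ (1 - α / 2) * |t| ^ (-(1 / 2) : ℝ) := by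
    rw [Real.sqrt_mul ht0.le, Real.sqrt_mul hα.le, Real.rpow_neg ht0.le, ← Real.sqrt_eq_rpow,
      Real.sqrt_eq_rpow (S ^ (α - 2)), ← Real.rpow_mul (by linarith),
      show 1 - α / 2 = -((α - 2) * (1 / 2)) by ring, Real.rpow_neg (by linarith)]
    field_simp
  have hone : 1 ≤ 1 / √(|t| * (α * (1 - α) * S ^ (α - 2))) := by
    have hS0 : 0 < S ^ (α - 2) := Real.rpow_pos_of_pos (by linarith) _
    rw [le_div_iff₀ (Real.sqrt_pos.2 (by positivity)), one_mul]
    refine Real.sqrt_le_one.2 (mul_le_one₀ ht1 (by positivity) ?_)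
    refine mul_le_one₀ (by nlinarith) (by positivity) ?_
    exact Real.rpow_le_one_of_one_le_of_nonpos hR' (by linarith)
  rw [show 33 / √(α * (1 - α)) * S ^ (1 - α / 2) * |t| ^ (-(1 / 2) : ℝ) =
    33 * (1 / √(α * (1 - α)) * S ^ (1 - α / 2) * |t| ^ (-(1 / 2) : ℝ)) by ring, ← hsqrt]
  rw [div_eq_mul_one_div] at hA hB
  have e1 : ∑ n ∈ Finset.range (R + 1), Complex.exp
      ((((n : ℕ) : ℤ) * x - |(((n : ℕ) : ℤ) : ℝ)| ^ α * t : ℝ) * Complex.I) =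
      ∑ n ∈ Finset.range (R + 1), Complex.exp ((n * x + (n : ℝ) ^ α * |t| : ℝ) * Complex.I) := by
    refine Finset.sum_congr rfl fun n _ => ?_
    rw [abs_of_neg hneg, Int.cast_natCast, Nat.abs_cast]
    congr 3
    ring
  have e2 : ∑ n ∈ Finset.range (R + 1), Complex.exp
      (((-((n : ℕ) : ℤ) : ℤ) * x - |((-((n : ℕ) : ℤ) : ℤ) : ℝ)| ^ α * t : ℝ) * Complex.I) =
      ∑ n ∈ Finset.range (R + 1), Complex.exp ((n * -x + (n : ℝ) ^ α * |t| : ℝ) * Complex.I) := by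
    refine Finset.sum_congr rfl fun n _ => ?_
    rw [abs_of_neg hneg, Int.cast_neg, Int.cast_natCast, abs_neg, Nat.abs_cast]
    congr 3
    ring
  rw [e1, e2]
  refine (norm_sub_le _ _).trans ?_
  refine (add_le_add_left (norm_add_le _ _) _).trans ?_
  rw [Complex.norm_exp_ofReal_mul_I]
  linarith

theorem measurable_abs_sub_rpow (t : ℝ) (a : ℝ) :
    Measurable fun s : ℝ => ENNReal.ofReal (|t - s| ^ a) := by
  fun_prop

theorem lintegral_Ioi_two_mul_rpow {L : ℝ} (hL : 0 < L) :
    ∫⁻ a in Ioi L, ENNReal.ofReal (2 * a ^ (-2 : ℝ)) = ENNReal.ofReal (2 / L) := by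
  have hi : IntegrableOn (fun a : ℝ => 2 * a ^ (-2 : ℝ)) (Ioi L) :=
    (integrableOn_Ioi_rpow_of_lt (by norm_num) hL).const_mul 2
  rw [← ofReal_integral_eq_lintegral_ofReal hi]
  · rw [integral_const_mul, integral_Ioi_rpow_of_lt (by norm_num) hL]
    congr 1
    norm_num
    rw [Real.rpow_neg_one]
    ring
  · filter_upwards [ae_restrict_mem measurableSet_Ioi] with a ha
    have : (0 : ℝ) < a := hL.trans ha
    positivity

theorem setLIntegral_abs_sub_rpow_le {μ : Measure ℝ} (hμ : μ ≤ volume) (t : ℝ) (E : Set ℝ)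
    (hE : μ E ≠ ⊤) :
    ∫⁻ s in E, ENNReal.ofReal (|t - s| ^ (-(1 / 2) : ℝ)) ∂μ ≤ 3 * μ E ^ (1 / 2 : ℝ) := by
  rcases eq_or_ne (μ E) 0 with h0 | h0
  · rw [setLIntegral_measure_zero _ _ h0]
    exact zero_le
  set m := (μ E).toReal with hm
  have hm0 : 0 < m := ENNReal.toReal_pos h0 hE
  have hmE : μ E = ENNReal.ofReal m := (ENNReal.ofReal_toReal hE).symm
  rw [lintegral_eq_lintegral_meas_le _ (ae_of_all _ fun s => by positivity)
    (by fun_prop)]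
  set L := m ^ (-(1 / 2) : ℝ) with hL
  have hL0 : 0 < L := by positivity
  rw [← Ioc_union_Ioi_eq_Ioi hL0.le]
  refine (lintegral_union_le _ _ _).trans ?_
  have h1 : ∫⁻ a in Ioc 0 L, (μ.restrict E) {s | a ≤ |t - s| ^ (-(1 / 2) : ℝ)} ≤
      ENNReal.ofReal (m ^ (1 / 2 : ℝ)) := by
    calc _ ≤ ∫⁻ a in Ioc 0 L, ENNReal.ofReal m := by
          refine lintegral_mono fun a => ?_
          refine (measure_mono (subset_univ _)).trans ?_
          rw [Measure.restrict_apply_univ, hmE]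
      _ = ENNReal.ofReal (m ^ (1 / 2 : ℝ)) := by
          rw [setLIntegral_const, Real.volume_Ioc, sub_zero, ← ENNReal.ofReal_mul hm0.le, hL]
          congr 1
          nth_rw 1 [← Real.rpow_one m]
          rw [← Real.rpow_add hm0]
          norm_num
  have h2 : ∫⁻ a in Ioi L, (μ.restrict E) {s | a ≤ |t - s| ^ (-(1 / 2) : ℝ)} ≤
      ENNReal.ofReal (2 * m ^ (1 / 2 : ℝ)) := by
    calc _ ≤ ∫⁻ a in Ioi L, ENNReal.ofReal (2 * a ^ (-2 : ℝ)) := by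
          refine setLIntegral_mono' measurableSet_Ioi fun a ha => ?_
          have ha0 : (0 : ℝ) < a := hL0.trans ha
          have hsub : {s | a ≤ |t - s| ^ (-(1 / 2) : ℝ)} ⊆ Metric.closedBall t (a ^ (-2 : ℝ)) := by
            intro s hs
            rw [Metric.mem_closedBall, dist_comm, Real.dist_eq]
            rcases (abs_nonneg (t - s)).eq_or_lt with h | h
            · rw [← h]
              positivity
            · have := Real.rpow_le_rpow_of_nonpos ha0 hs (z := -2) (by norm_num)
              rwa [← Real.rpow_mul h.le, show -(1 / 2) * -2 = (1 : ℝ) by norm_num,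
                Real.rpow_one] at this
          refine (Measure.restrict_apply_le _ _).trans ((measure_mono hsub).trans ?_)
          refine (hμ _).trans ?_
          rw [Real.volume_closedBall]
      _ = ENNReal.ofReal (2 * m ^ (1 / 2 : ℝ)) := by
          rw [lintegral_Ioi_two_mul_rpow hL0, hL, Real.rpow_neg hm0.le, div_inv_eq_mul]
  refine (add_le_add h1 h2).trans (le_of_eq ?_)
  rw [hmE, ENNReal.ofReal_rpow_of_pos hm0, ← ENNReal.ofReal_add (by positivity) (by positivity),
    show (3 : ℝ≥0∞) = ENNReal.ofReal 3 by simp, ← ENNReal.ofReal_mul (by norm_num)]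
  congr 1
  ring

theorem setLIntegral_pow_mul_abs_sub_rpow_le {μ : Measure ℝ} (hμ : μ ≤ volume) {φ : ℝ → ℝ}
    (hφ : Measurable φ) (hφ0 : ∀ s, 0 ≤ φ s) (hA : ∫⁻ s, ENNReal.ofReal (φ s ^ 4) ∂μ ≠ ⊤)
    (t M : ℝ) :
    ∫⁻ s in {s | φ s ≤ M},
        ENNReal.ofReal (φ s ^ 3) * ENNReal.ofReal (|t - s| ^ (-(1 / 2) : ℝ)) ∂μ ≤
      9 * (∫⁻ s, ENNReal.ofReal (φ s ^ 4) ∂μ) ^ (1 / 2 : ℝ) * ENNReal.ofReal M := by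
  set A := ∫⁻ s, ENNReal.ofReal (φ s ^ 4) ∂μ with hAdef
  set k : ℝ → ℝ≥0∞ := fun s => ENNReal.ofReal (|t - s| ^ (-(1 / 2) : ℝ)) with hk
  have hkm : Measurable k := measurable_abs_sub_rpow t _
  set ν := (μ.restrict {s | φ s ≤ M}).withDensity k with hν
  have e1 : ∫⁻ s in {s | φ s ≤ M}, ENNReal.ofReal (φ s ^ 3) * k s ∂μ =
      ∫⁻ s, ENNReal.ofReal (∫ a in 0..φ s, 3 * a ^ 2) ∂ν := by
    rw [hν, lintegral_withDensity_eq_lintegral_mul _ hkm (by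
      simp only [intervalIntegral.integral_const_mul, integral_pow]
      fun_prop)]
    refine lintegral_congr fun s => ?_
    simp only [intervalIntegral.integral_const_mul, integral_pow, Pi.mul_apply]
    rw [mul_comm]
    congr 2
    norm_num
    ring
  rw [e1, lintegral_comp_eq_lintegral_meas_le_mul ν (ae_of_all _ hφ0) hφ.aemeasurable
    (fun a _ => (by fun_prop : Continuous fun a : ℝ => 3 * a ^ 2).intervalIntegrable _ _)
    (ae_of_all _ fun a => by positivity)]
  have hpt : ∀ a ∈ Ioi (0 : ℝ), ν {s | a ≤ φ s} * ENNReal.ofReal (3 * a ^ 2) ≤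
      (Ioc 0 M).indicator (fun _ => 9 * A ^ (1 / 2 : ℝ)) a := by
    intro a ha
    have ha0 : (0 : ℝ) < a := ha
    have hSa : MeasurableSet {s | a ≤ φ s} := measurableSet_le measurable_const hφ
    rw [hν, withDensity_apply _ hSa, Measure.restrict_restrict hSa]
    by_cases haM : a ≤ M
    · rw [indicator_of_mem (show a ∈ Ioc 0 M from ⟨ha, haM⟩)]
      have ha4 : ENNReal.ofReal (a ^ 4) ≠ 0 := (ENNReal.ofReal_pos.2 (by positivity)).ne'
      have hcheb : μ ({s | a ≤ φ s} ∩ {s | φ s ≤ M}) ≤ A / ENNReal.ofReal (a ^ 4) := by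
        refine le_trans (measure_mono fun s hs => ?_) (meas_ge_le_lintegral_div
          (by fun_prop : AEMeasurable (fun s => ENNReal.ofReal (φ s ^ 4)) μ) ha4
          ENNReal.ofReal_ne_top)
        exact ENNReal.ofReal_le_ofReal (pow_le_pow_left₀ ha0.le hs.1 4)
      have hfin : μ ({s | a ≤ φ s} ∩ {s | φ s ≤ M}) ≠ ⊤ :=
        (hcheb.trans_lt (ENNReal.div_lt_top hA ha4)).ne
      refine (mul_le_mul_left ((setLIntegral_abs_sub_rpow_le hμ t _ hfin).trans
        (mul_le_mul_right (ENNReal.rpow_le_rpow hcheb (by norm_num)) _)) _).trans (le_of_eq ?_)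
      rw [ENNReal.div_rpow_of_nonneg _ _ (by norm_num), ENNReal.ofReal_rpow_of_pos (by positivity),
        ← Real.sqrt_eq_rpow, show a ^ 4 = (a ^ 2) ^ 2 by ring, Real.sqrt_sq (by positivity),
        ENNReal.ofReal_mul (by norm_num), ENNReal.ofReal_ofNat, mul_mul_mul_comm, mul_comm _ (3 : ℝ≥0∞),
        mul_assoc 3, ENNReal.div_mul_cancel (ENNReal.ofReal_pos.2 (by positivity)).ne'
          ENNReal.ofReal_ne_top, ← mul_assoc]
      norm_num
    · rw [show {s | a ≤ φ s} ∩ {s | φ s ≤ M} = ∅ by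
        ext s
        simp only [mem_inter_iff, mem_ofPred_eq, mem_empty_iff_false, iff_false, not_and, not_le]
        exact fun h => (not_le.1 haM).trans_le h]
      simp
  refine (setLIntegral_mono' measurableSet_Ioi hpt).trans ?_
  rw [← lintegral_indicator measurableSet_Ioi]
  refine (lintegral_mono (indicator_le_self _ _)).trans ?_
  rw [lintegral_indicator measurableSet_Ioc, setLIntegral_const, Real.volume_Ioc, sub_zero]

/-- The endpoint case of the Hardy-Littlewood-Sobolev inequality
`∬ f(t) f(s) |t - s|^{-1/2} ≤ C ‖f‖_{4/3}²`, for `f = φ³`. -/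
theorem lintegral_lintegral_pow_mul_abs_sub_rpow_le {μ : Measure ℝ} [SFinite μ] (hμ : μ ≤ volume)
    {φ : ℝ → ℝ} (hφ : Measurable φ) (hφ0 : ∀ s, 0 ≤ φ s)
    (hA : ∫⁻ s, ENNReal.ofReal (φ s ^ 4) ∂μ ≠ ⊤) :
    ∫⁻ t, ∫⁻ s, ENNReal.ofReal (φ t ^ 3) *
        (ENNReal.ofReal (φ s ^ 3) * ENNReal.ofReal (|t - s| ^ (-(1 / 2) : ℝ))) ∂μ ∂μ ≤
      18 * (∫⁻ s, ENNReal.ofReal (φ s ^ 4) ∂μ) ^ (3 / 2 : ℝ) := by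
  set A := ∫⁻ s, ENNReal.ofReal (φ s ^ 4) ∂μ with hAdef
  set F : ℝ → ℝ → ℝ≥0∞ := fun t s => ENNReal.ofReal (φ t ^ 3) *
    ({s | φ s ≤ φ t}.indicator (fun s => ENNReal.ofReal (φ s ^ 3) *
      ENNReal.ofReal (|t - s| ^ (-(1 / 2) : ℝ))) s) with hF
  have hFm : Measurable (Function.uncurry F) := by
    have h1 : Measurable fun p : ℝ × ℝ => ENNReal.ofReal (φ p.2 ^ 3) *
      ENNReal.ofReal (|p.1 - p.2| ^ (-(1 / 2) : ℝ)) := by fun_prop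
    have h2 : MeasurableSet {p : ℝ × ℝ | φ p.2 ≤ φ p.1} :=
      measurableSet_le (by fun_prop) (by fun_prop)
    exact (by fun_prop : Measurable fun p : ℝ × ℝ => ENNReal.ofReal (φ p.1 ^ 3)).mul
      (h1.indicator h2)
  have hF1 : ∫⁻ t, ∫⁻ s, F t s ∂μ ∂μ ≤ 9 * A ^ (3 / 2 : ℝ) := by
    calc ∫⁻ t, ∫⁻ s, F t s ∂μ ∂μ
        ≤ ∫⁻ t, 9 * A ^ (1 / 2 : ℝ) * ENNReal.ofReal (φ t ^ 4) ∂μ := by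
          refine lintegral_mono fun t => ?_
          simp only [hF]
          rw [lintegral_const_mul' _ _ ENNReal.ofReal_ne_top,
            lintegral_indicator (measurableSet_le hφ measurable_const)]
          refine (mul_le_mul_right
            (setLIntegral_pow_mul_abs_sub_rpow_le hμ hφ hφ0 hA t (φ t)) _).trans (le_of_eq ?_)
          rw [mul_left_comm, ← ENNReal.ofReal_mul (by have := hφ0 t; positivity), ← pow_succ]
      _ = 9 * A ^ (3 / 2 : ℝ) := by
          rw [lintegral_const_mul _ (by fun_prop), ← hAdef, mul_assoc]
          congr 1
          nth_rw 2 [← ENNReal.rpow_one A]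
          rw [← ENNReal.rpow_add_of_nonneg _ _ (by norm_num) (by norm_num)]
          norm_num
  calc _ ≤ ∫⁻ t, ∫⁻ s, (F t s + F s t) ∂μ ∂μ := by
        refine lintegral_mono fun t => lintegral_mono fun s => ?_
        simp only [hF, indicator, mem_ofPred_eq]
        rcases le_total (φ s) (φ t) with h | h
        · rw [if_pos h]
          exact le_self_add
        · rw [if_pos h, abs_sub_comm s t]
          refine le_trans (le_of_eq ?_) le_add_self
          ring
    _ = ∫⁻ t, ∫⁻ s, F t s ∂μ ∂μ + ∫⁻ t, ∫⁻ s, F s t ∂μ ∂μ := by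
        rw [← lintegral_add_left (Measurable.lintegral_prod_right hFm)]
        refine lintegral_congr fun t => ?_
        exact lintegral_add_left (hFm.comp measurable_prodMk_left) _
    _ ≤ 9 * A ^ (3 / 2 : ℝ) + 9 * A ^ (3 / 2 : ℝ) := by
        rw [lintegral_lintegral_swap (f := fun t s => F s t)
          (hFm.comp measurable_swap).aemeasurable]
        exact add_le_add hF1 hF1
    _ = 18 * A ^ (3 / 2 : ℝ) := by
        rw [← add_mul]
        norm_num

/-- The linearized maximal estimate: the `TT*` argument along a measurable curve `x`. -/
theorem integral_norm_pow_le {α : ℝ} (h0 : 0 < α) (h1 : α < 1) {R : ℕ} (hR : 1 ≤ R)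
    (c : ℤ → ℂ) {x : ℝ → ℝ} (hx : Measurable x) :
    ∫ t in Ioo (0 : ℝ) 1, ‖∑ k ∈ Finset.Ioo (-(R : ℤ)) R,
        c k * Complex.exp ((k * x t - |(k : ℝ)| ^ α * t : ℝ) * Complex.I)‖ ^ 4 ≤
      (18 * (33 / √(α * (1 - α)) * (R : ℝ) ^ (1 - α / 2)) *
        ∑ k ∈ Finset.Ioo (-(R : ℤ)) R, ‖c k‖ ^ 2) ^ 2 := by
  set S := Finset.Ioo (-(R : ℤ)) R
  set μ : Measure ℝ := volume.restrict (Ioo 0 1) with hμ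
  set e : ℤ → ℝ → ℂ := fun k t => Complex.exp ((k * x t - |(k : ℝ)| ^ α * t : ℝ) * Complex.I)
    with he
  set κ : ℝ := 33 / √(α * (1 - α)) * (R : ℝ) ^ (1 - α / 2) with hκ
  have hκ0 : 0 ≤ κ := by positivity
  set Φ : ℝ → ℂ := fun t => ∑ k ∈ S, c k * e k t with hΦ
  set w : ℝ → ℂ := fun t => starRingEnd ℂ (Φ t) * ((‖Φ t‖ ^ 2 : ℝ) : ℂ) with hw
  set A : ℝ := ∫ t, ‖Φ t‖ ^ 4 ∂μ with hA
  have hem : ∀ k, Measurable (e k) := fun k => by fun_prop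
  have hen : ∀ k t, ‖e k t‖ = 1 := fun k t => Complex.norm_exp_ofReal_mul_I _
  have hΦm : Measurable Φ := Finset.measurable_fun_sum _ fun k _ => (hem k).const_mul _
  set B := ∑ k ∈ S, ‖c k‖
  have hΦB : ∀ t, ‖Φ t‖ ≤ B := fun t => by
    refine norm_sum_le_of_le _ fun k _ => ?_
    rw [norm_mul, hen, mul_one]
  have hwm : Measurable w := by
    have : Measurable fun t => starRingEnd ℂ (Φ t) := Complex.continuous_conj.measurable.comp hΦm
    exact this.mul (Complex.measurable_ofReal.comp (hΦm.norm.pow_const 2))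
  have hwn : ∀ t, ‖w t‖ = ‖Φ t‖ ^ 3 := fun t => by
    simp only [hw]
    rw [norm_mul, RCLike.norm_conj, Complex.norm_real, norm_pow, norm_norm]
    ring
  have hewi : ∀ k, Integrable (fun t => e k t * w t) μ := fun k => by
    refine Integrable.of_bound ((hem k).mul hwm).aestronglyMeasurable (B ^ 3)
      (ae_of_all _ fun t => ?_)
    rw [norm_mul, hen, one_mul, hwn]
    exact pow_le_pow_left₀ (norm_nonneg _) (hΦB t) 3
  have hAi : Integrable (fun t => ‖Φ t‖ ^ 4) μ := by
    refine Integrable.of_bound (hΦm.norm.pow_const 4).aestronglyMeasurable (B ^ 4)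
      (ae_of_all _ fun t => ?_)
    rw [norm_pow, norm_norm]
    exact pow_le_pow_left₀ (norm_nonneg _) (hΦB t) 4
  have hA0 : 0 ≤ A := integral_nonneg fun t => by positivity
  have hAl : ∫⁻ t, ENNReal.ofReal (‖Φ t‖ ^ 4) ∂μ = ENNReal.ofReal A :=
    (ofReal_integral_eq_lintegral_ofReal hAi (ae_of_all _ fun t => by positivity)).symm
  set b : ℤ → ℂ := fun k => ∫ t, e k t * w t ∂μ with hb
  have hAb : (A : ℂ) = ∑ k ∈ S, c k * b k := by
    simp only [hb, ← integral_const_mul]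
    rw [← integral_finsetSum _ fun k _ => (hewi k).const_mul _, hA, ← integral_complex_ofReal]
    refine integral_congr_ae (ae_of_all _ fun t => ?_)
    have h1 : ∑ k ∈ S, c k * (e k t * w t) = Φ t * w t := by
      rw [hΦ, Finset.sum_mul]
      exact Finset.sum_congr rfl fun k _ => by ring
    change ((‖Φ t‖ ^ 4 : ℝ) : ℂ) = ∑ k ∈ S, c k * (e k t * w t)
    rw [h1]
    simp only [hw]
    rw [← mul_assoc, Complex.mul_conj']
    push_cast
    ring
  have hA2 : A ^ 2 ≤ (∑ k ∈ S, ‖c k‖ ^ 2) * ∑ k ∈ S, ‖b k‖ ^ 2 := by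
    refine le_trans ?_ (Finset.sum_mul_sq_le_sq_mul_sq S _ _)
    refine pow_le_pow_left₀ hA0 ?_ 2
    calc A = ‖(A : ℂ)‖ := by rw [Complex.norm_real, Real.norm_of_nonneg hA0]
      _ ≤ _ := by
        rw [hAb]
        exact norm_sum_le_of_le _ fun k _ => (norm_mul _ _).le
  have hbb : ∑ k ∈ S, ‖b k‖ ^ 2 ≤ κ * (18 * A ^ (3 / 2 : ℝ)) := by
    set G : ℝ × ℝ → ℂ := fun z => ∑ k ∈ S,
      (e k z.1 * w z.1) * starRingEnd ℂ (e k z.2 * w z.2) with hG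
    have hsum : ((∑ k ∈ S, ‖b k‖ ^ 2 : ℝ) : ℂ) = ∫ z, G z ∂μ.prod μ := by
      have hconj : ∀ k, Integrable (fun s => starRingEnd ℂ (e k s * w s)) μ := fun k =>
        Complex.conjCLE.toContinuousLinearMap.integrable_comp (hewi k)
      simp only [hG]
      rw [integral_finsetSum _ fun k _ => (hewi k).mul_prod (hconj k)]
      push_cast
      refine Finset.sum_congr rfl fun k _ => ?_
      rw [integral_prod_mul (fun t => e k t * w t) (fun s => starRingEnd ℂ (e k s * w s)),
        integral_conj, Complex.mul_conj']
    have hGm : Measurable G := by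
      refine Finset.measurable_fun_sum _ fun k _ => ?_
      have h := (hem k).mul hwm
      exact (h.comp measurable_fst).mul
        (Complex.continuous_conj.measurable.comp (h.comp measurable_snd))
    have hGK : ∀ t ∈ Ioo (0 : ℝ) 1, ∀ s ∈ Ioo (0 : ℝ) 1, t ≠ s →
        ‖G (t, s)‖ ≤ κ * (‖Φ t‖ ^ 3 * (‖Φ s‖ ^ 3 * |t - s| ^ (-(1 / 2) : ℝ))) := by
      intro t ht s hs hts
      have h2 : G (t, s) = (w t * starRingEnd ℂ (w s)) * ∑ k ∈ S,
          Complex.exp ((k * (x t - x s) - |(k : ℝ)| ^ α * (t - s) : ℝ) * Complex.I) := by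
        rw [hG, Finset.mul_sum]
        refine Finset.sum_congr rfl fun k _ => ?_
        have h3 : Complex.exp ((k * (x t - x s) - |(k : ℝ)| ^ α * (t - s) : ℝ) * Complex.I) =
            e k t * starRingEnd ℂ (e k s) := by
          simp only [he]
          rw [← Complex.exp_conj, ← Complex.exp_add, map_mul, Complex.conj_I, Complex.conj_ofReal]
          congr 1
          push_cast
          ring
        rw [h3, map_mul]
        ring
      have h4 := norm_kernel_le h0 h1 (sub_ne_zero.2 hts)
        (abs_le.2 ⟨by linarith [ht.1, hs.2], by linarith [ht.2, hs.1]⟩) hR (x t - x s)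
      rw [h2, norm_mul, norm_mul, RCLike.norm_conj, hwn, hwn]
      refine (mul_le_mul_of_nonneg_left h4 (by positivity)).trans (le_of_eq ?_)
      ring
    have hGl : ∫⁻ z, ‖G z‖ₑ ∂μ.prod μ ≤ ENNReal.ofReal (κ * (18 * A ^ (3 / 2 : ℝ))) := by
      rw [lintegral_prod _ hGm.enorm.aemeasurable]
      calc ∫⁻ t, ∫⁻ s, ‖G (t, s)‖ₑ ∂μ ∂μ
          ≤ ∫⁻ t, ∫⁻ s, ENNReal.ofReal κ * (ENNReal.ofReal (‖Φ t‖ ^ 3) *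
              (ENNReal.ofReal (‖Φ s‖ ^ 3) * ENNReal.ofReal (|t - s| ^ (-(1 / 2) : ℝ)))) ∂μ ∂μ := by
            refine setLIntegral_mono_ae' measurableSet_Ioo (ae_of_all _ fun t ht => ?_)
            refine setLIntegral_mono_ae' measurableSet_Ioo ?_
            filter_upwards [Measure.ae_ne volume t] with s hs hs'
            rw [← ENNReal.ofReal_mul (by positivity), ← ENNReal.ofReal_mul (by positivity),
              ← ENNReal.ofReal_mul hκ0, ← ofReal_norm]
            exact ENNReal.ofReal_le_ofReal (hGK t ht s hs' hs.symm)
        _ = ENNReal.ofReal κ * ∫⁻ t, ∫⁻ s, ENNReal.ofReal (‖Φ t‖ ^ 3) *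
              (ENNReal.ofReal (‖Φ s‖ ^ 3) * ENNReal.ofReal (|t - s| ^ (-(1 / 2) : ℝ))) ∂μ ∂μ := by
            simp_rw [lintegral_const_mul' _ _ ENNReal.ofReal_ne_top]
        _ ≤ ENNReal.ofReal κ * (18 * ENNReal.ofReal A ^ (3 / 2 : ℝ)) := by
            rw [← hAl]
            refine mul_le_mul_right (lintegral_lintegral_pow_mul_abs_sub_rpow_le
              Measure.restrict_le_self hΦm.norm (fun _ => norm_nonneg _) ?_) _
            rw [hAl]
            exact ENNReal.ofReal_ne_top
        _ = ENNReal.ofReal (κ * (18 * A ^ (3 / 2 : ℝ))) := by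
            rw [ENNReal.ofReal_rpow_of_nonneg hA0 (by norm_num),
              ENNReal.ofReal_mul (p := κ) (q := 18 * _) hκ0,
              ENNReal.ofReal_mul (p := 18) (by norm_num), ENNReal.ofReal_ofNat]
    have h5 := (enorm_integral_le_lintegral_enorm G (μ := μ.prod μ)).trans hGl
    rw [← hsum, ← ofReal_norm, ENNReal.ofReal_le_ofReal_iff (by positivity),
      Complex.norm_real] at h5
    exact (le_abs_self _).trans h5
  have hfin : A ^ 2 ≤ (18 * κ * ∑ k ∈ S, ‖c k‖ ^ 2) * A ^ (3 / 2 : ℝ) := by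
    refine hA2.trans ((mul_le_mul_of_nonneg_left hbb (by positivity)).trans (le_of_eq ?_))
    ring
  have hD0 : 0 ≤ 18 * κ * ∑ k ∈ S, ‖c k‖ ^ 2 := by positivity
  rcases hA0.eq_or_lt with h | h
  · rw [← h]
    positivity
  have h6 : A ^ (1 / 2 : ℝ) ≤ 18 * κ * ∑ k ∈ S, ‖c k‖ ^ 2 := by
    refine le_of_mul_le_mul_right ?_ (Real.rpow_pos_of_pos h (3 / 2))
    rw [← Real.rpow_add h]
    norm_num
    exact hfin
  calc A = (A ^ (1 / 2 : ℝ)) ^ 2 := by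
        rw [← Real.sqrt_eq_rpow, Real.sq_sqrt hA0]
    _ ≤ _ := pow_le_pow_left₀ (by positivity) h6 2

/-- The trigonometric polynomial `∑_{|k| < R} cₖ e^{i(kx - |k|^α t)}`. -/
noncomputable def trigPoly (α : ℝ) (R : ℕ) (c : ℤ → ℂ) (t : ℝ) : C(Torus, ℂ) :=
  ∑ k ∈ Finset.Ioo (-(R : ℤ)) R,
    (Complex.exp (-(Complex.I * t * (|(k : ℝ)| ^ α : ℝ))) * c k) • fourier k

theorem continuous_trigPoly (α : ℝ) (R : ℕ) (c : ℤ → ℂ) : Continuous (trigPoly α R c) := by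
  unfold trigPoly
  fun_prop

theorem trigPoly_apply_coe (α : ℝ) (R : ℕ) (c : ℤ → ℂ) (t x : ℝ) :
    trigPoly α R c t (x : Torus) = ∑ k ∈ Finset.Ioo (-(R : ℤ)) R,
      c k * Complex.exp ((k * x - |(k : ℝ)| ^ α * t : ℝ) * Complex.I) := by
  rw [trigPoly, ContinuousMap.sum_apply]
  refine Finset.sum_congr rfl fun k _ => ?_
  rw [ContinuousMap.smul_apply, fourier_coe_apply, smul_eq_mul, mul_comm _ (c k), mul_assoc,
    ← Complex.exp_add]
  congr 2
  have : (π : ℂ) ≠ 0 := by exact_mod_cast Real.pi_ne_zero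
  push_cast
  field_simp
  ring

/-- A measurable choice of points where continuous functions nearly attain their norms. -/
theorem exists_measurable_norm_le {W : ℝ → C(Torus, ℂ)} (hW : Continuous W) :
    ∃ x : ℝ → ℝ, Measurable x ∧ ∀ t, ‖W t‖ ≤ 2 * ‖W t (x t : Torus)‖ := by
  classical
  have hd : DenseRange fun n => (TopologicalSpace.denseSeq ℝ n : Torus) :=
    (QuotientAddGroup.mk_surjective.denseRange).comp (TopologicalSpace.denseRange_denseSeq ℝ)
      (AddCircle.continuous_mk' _)
  have hex : ∀ t, ∃ n, ‖W t‖ ≤ 2 * ‖W t (TopologicalSpace.denseSeq ℝ n : Torus)‖ := by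
    intro t
    by_contra! h
    have h1 : ∀ y : Torus, ‖W t y‖ ≤ ‖W t‖ / 2 := by
      intro y
      refine hd.induction_on (p := fun y => ‖W t y‖ ≤ ‖W t‖ / 2) y
        (isClosed_le (by fun_prop) continuous_const) fun n => ?_
      linarith [h n]
    have h2 := (ContinuousMap.norm_le _ (by positivity)).2 h1
    have h3 := h 0
    have h4 := norm_nonneg (W t (TopologicalSpace.denseSeq ℝ 0 : Torus))
    linarith
  refine ⟨fun t => TopologicalSpace.denseSeq ℝ (Nat.find (hex t)), ?_, fun t => Nat.find_spec (hex t)⟩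
  refine (measurable_of_countable _).comp (measurable_find hex fun n => ?_)
  refine (isClosed_le (by fun_prop) ?_).measurableSet
  exact continuous_const.mul ((continuous_eval_const _).comp hW).norm

theorem integral_norm_trigPoly_pow_le {α : ℝ} (h0 : 0 < α) (h1 : α < 1) {R : ℕ} (hR : 1 ≤ R)
    (c : ℤ → ℂ) :
    ∫ t in Ioo (0 : ℝ) 1, ‖trigPoly α R c t‖ ^ 4 ≤
      16 * (18 * (33 / √(α * (1 - α)) * (R : ℝ) ^ (1 - α / 2)) *
        ∑ k ∈ Finset.Ioo (-(R : ℤ)) R, ‖c k‖ ^ 2) ^ 2 := by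
  obtain ⟨x, hx, hxW⟩ := exists_measurable_norm_le (continuous_trigPoly α R c)
  refine le_trans ?_ (mul_le_mul_of_nonneg_left (integral_norm_pow_le h0 h1 hR c hx)
    (by norm_num))
  rw [← integral_const_mul]
  have hm : Measurable fun t => ∑ k ∈ Finset.Ioo (-(R : ℤ)) R,
      c k * Complex.exp ((k * x t - |(k : ℝ)| ^ α * t : ℝ) * Complex.I) :=
    Finset.measurable_fun_sum _ fun k _ => by fun_prop
  refine integral_mono_of_nonneg (ae_of_all _ fun t => by positivity) ?_
    (ae_of_all _ fun t => ?_)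
  · refine Integrable.const_mul ?_ _
    refine Integrable.of_bound (hm.norm.pow_const 4).aestronglyMeasurable
      ((∑ k ∈ Finset.Ioo (-(R : ℤ)) R, ‖c k‖) ^ 4) (ae_of_all _ fun t => ?_)
    rw [norm_pow, norm_norm]
    refine pow_le_pow_left₀ (norm_nonneg _) (norm_sum_le_of_le _ fun k _ => ?_) 4
    rw [norm_mul, Complex.norm_exp_ofReal_mul_I, mul_one]
  · have h := pow_le_pow_left₀ (norm_nonneg _) (hxW t) 4
    rw [trigPoly_apply_coe, mul_pow] at h
    norm_num at h ⊢
    exact h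

theorem hasSum_norm_sq_fourierCoeff (u : L2Torus) :
    HasSum (fun k => ‖fourierCoeff u k‖ ^ 2) (‖u‖ ^ 2) := by
  have h := lp.hasSum_norm (p := 2) (by norm_num) (fourierBasis.repr u)
  simp only [fourierBasis_repr, ENNReal.toReal_ofNat, Real.rpow_ofNat,
    LinearIsometryEquiv.norm_map] at h
  exact h

theorem fourierCoeff_eq_of_hasSum {a : ℤ → ℂ} {v : L2Torus}
    (h : HasSum (fun k => a k • fourierLp 2 k) v) (k : ℤ) : fourierCoeff v k = a k := by
  have h1 := (innerSL ℂ (fourierLp 2 k : L2Torus)).hasSum h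
  rw [← fourierBasis_repr, HilbertBasis.repr_apply_apply, coe_fourierBasis]
  refine h1.unique ?_
  convert! hasSum_ite_eq k (a k) using 2 with l
  rw [innerSL_apply_apply, inner_smul_right,
    orthonormal_iff_ite.1 orthonormal_fourier]
  simp only [eq_comm (a := k)]
  split_ifs with h
  · rw [h, mul_one]
  · rw [mul_zero]

theorem fourierCoeff_fourierMul {m : ℤ → ℂ} {B : ℝ} (hm : ∀ k, ‖m k‖ ≤ B) (u : L2Torus) (k : ℤ) :
    fourierCoeff (fourierMul m u) k = m k * fourierCoeff u k :=
  fourierCoeff_eq_of_hasSum (hasSum_fourierMul hm u) k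

theorem norm_fourierMul_le {m : ℤ → ℂ} (hm : ∀ k, ‖m k‖ ≤ 1) (u : L2Torus) :
    ‖fourierMul m u‖ ≤ ‖u‖ := by
  refine le_of_sq_le_sq ?_ (norm_nonneg _)
  refine hasSum_le (fun k => ?_) (hasSum_norm_sq_fourierCoeff _) (hasSum_norm_sq_fourierCoeff u)
  rw [fourierCoeff_fourierMul hm, norm_mul]
  exact pow_le_pow_left₀ (by positivity) (mul_le_of_le_one_left (norm_nonneg _) (hm k)) 2

theorem norm_exp_neg_I_mul (t a : ℝ) : ‖Complex.exp (-(Complex.I * t * a))‖ = 1 := by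
  rw [show -(Complex.I * t * a) = ((-(t * a) : ℝ) : ℂ) * Complex.I by push_cast; ring]
  exact Complex.norm_exp_ofReal_mul_I _

theorem L4LinfNormLE.mono {f : ℝ → L2Torus} {M M' : ℝ} (h : L4LinfNormLE f M) (hM : M ≤ M') :
    L4LinfNormLE f M' := by
  obtain ⟨F, hF, hFM⟩ := h
  exact ⟨F, hF, hFM.trans hM⟩

theorem propagator_eq_toLp_trigPoly {α : ℝ} {R : ℕ} {u : L2Torus}
    (hu : ∀ k ∉ Finset.Ioo (-(R : ℤ)) R, fourierCoeff u k = 0) (t : ℝ) :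
    propagator α t u =
      ContinuousMap.toLp 2 torusMeasure ℂ (trigPoly α R (fourierCoeff u) t) := by
  rw [propagator, fourierMul, tsum_eq_sum (s := Finset.Ioo (-(R : ℤ)) R), trigPoly, map_sum]
  · exact Finset.sum_congr rfl fun k _ => (map_smul _ _ _).symm
  · intro k hk
    rw [hu k hk, mul_zero, zero_smul]

theorem norm_toLp_top_le (f : C(Torus, ℂ)) : ‖ContinuousMap.toLp ∞ torusMeasure ℂ f‖ ≤ ‖f‖ := by
  refine (ContinuousLinearMap.le_of_opNorm_le _ (ContinuousMap.toLp_norm_le torusMeasure) f).trans ?_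
  simp

/-- The constant in the Strichartz estimate for frequency localized functions. -/
noncomputable def strichartzConst (α : ℝ) : ℝ := 2 * √(18 * (33 / √(α * (1 - α))))

theorem strichartzConst_pos {α : ℝ} (h0 : 0 < α) (h1 : α < 1) : 0 < strichartzConst α := by
  have : 0 < α * (1 - α) := mul_pos h0 (by linarith)
  unfold strichartzConst
  positivity

/-- The Strichartz estimate for functions with frequencies in `(-R, R)`. -/
theorem l4LinfNormLE_propagator {α : ℝ} (h0 : 0 < α) (h1 : α < 1) {R : ℕ} (hR : 1 ≤ R)
    {u : L2Torus} (hu : ∀ k ∉ Finset.Ioo (-(R : ℤ)) R, fourierCoeff u k = 0) :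
    L4LinfNormLE (fun t => propagator α t u)
      (strichartzConst α * (R : ℝ) ^ (1 / 2 - α / 4) * ‖u‖) := by
  set X := strichartzConst α * (R : ℝ) ^ (1 / 2 - α / 4) * ‖u‖ with hX
  have hX0 : 0 ≤ X := by
    have := strichartzConst_pos h0 h1
    positivity
  set W := trigPoly α R (fourierCoeff u) with hW
  set f : ℝ → LinfTorus := fun t => ContinuousMap.toLp ∞ torusMeasure ℂ (W t) with hf
  have hWc : Continuous W := continuous_trigPoly α R _
  have hfc : Continuous f := (ContinuousLinearMap.continuous _).comp hWc
  have hWB : ∀ t, ‖W t‖ ≤ ∑ k ∈ Finset.Ioo (-(R : ℤ)) R, ‖fourierCoeff u k‖ := fun t => by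
    refine norm_sum_le_of_le _ fun k _ => ?_
    rw [norm_smul, norm_mul, norm_exp_neg_I_mul, one_mul, fourier_norm, mul_one]
  have hmem : MemLp f 4 (volume.restrict (Ioo (0 : ℝ) 1)) :=
    MemLp.of_bound hfc.aestronglyMeasurable _
      (ae_of_all _ fun t => (norm_toLp_top_le _).trans (hWB t))
  refine ⟨hmem.toLp f, ?_, ?_⟩
  · filter_upwards [hmem.coeFn_toLp] with t ht
    rw [ht, propagator_eq_toLp_trigPoly hu]
    exact (ContinuousMap.coeFn_toLp torusMeasure _).trans
      (ContinuousMap.coeFn_toLp torusMeasure _).symm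
  · rw [Lp.norm_toLp, hmem.eLpNorm_eq_integral_rpow_norm (by norm_num) (by norm_num),
      ENNReal.toReal_ofReal (by positivity)]
    simp only [ENNReal.toReal_ofNat, Real.rpow_ofNat]
    have hint : ∫ t in Ioo (0 : ℝ) 1, ‖f t‖ ^ 4 ≤ X ^ 4 := by
      calc ∫ t in Ioo (0 : ℝ) 1, ‖f t‖ ^ 4 ≤ ∫ t in Ioo (0 : ℝ) 1, ‖W t‖ ^ 4 := by
            refine integral_mono_of_nonneg (ae_of_all _ fun t => by positivity) ?_
              (ae_of_all _ fun t => pow_le_pow_left₀ (norm_nonneg _) (norm_toLp_top_le _) 4)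
            exact ((hWc.norm.pow 4).integrableOn_Icc (a := 0) (b := 1)).mono_set Ioo_subset_Icc_self
        _ ≤ _ := integral_norm_trigPoly_pow_le h0 h1 hR _
        _ = X ^ 4 := by
            have h2 : ∑ k ∈ Finset.Ioo (-(R : ℤ)) R, ‖fourierCoeff u k‖ ^ 2 = ‖u‖ ^ 2 := by
              rw [← (hasSum_norm_sq_fourierCoeff u).tsum_eq]
              refine (tsum_eq_sum fun k hk => ?_).symm
              rw [hu k hk]
              simp
            have h3 : ((R : ℝ) ^ (1 / 2 - α / 4)) ^ 4 = ((R : ℝ) ^ (1 - α / 2)) ^ 2 := by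
              rw [← Real.rpow_mul_natCast (by positivity), ← Real.rpow_mul_natCast (by positivity)]
              congr 1
              push_cast
              ring
            have h4 : strichartzConst α ^ 4 = 16 * (18 * (33 / √(α * (1 - α)))) ^ 2 := by
              rw [strichartzConst, mul_pow, show (4 : ℕ) = 2 * 2 by rfl, pow_mul √_,
                Real.sq_sqrt (by positivity)]
              norm_num
            rw [hX, mul_pow (_ * _) ‖u‖, mul_pow (strichartzConst α), h3, h4, h2]
            ring
    calc (∫ t in Ioo (0 : ℝ) 1, ‖f t‖ ^ 4) ^ (4 : ℝ)⁻¹ ≤ (X ^ 4) ^ (4 : ℝ)⁻¹ :=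
          Real.rpow_le_rpow (integral_nonneg fun t => by positivity) hint (by norm_num)
      _ = X := by
          simpa using Real.pow_rpow_inv_natCast hX0 (n := 4) (by norm_num)

theorem IsLPProfile.le_one {ψ : ℝ → ℝ} (hψ : IsLPProfile ψ) {x : ℝ} (hx : 0 ≤ x) : ψ x ≤ 1 := by
  by_cases h : x ∈ Ioo (1 / 2 : ℝ) 2
  · have h1 := le_hasSum (hψ.hasSum_one (4 * x) (by linarith [h.1])) 1
      fun j _ => hψ.nonneg _ (by positivity)
    norm_num at h1
    exact h1
  · rw [hψ.eq_zero x hx h]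
    exact zero_le_one

theorem IsLPProfile.lpSymbol_zero_of_abs_le {ψ : ℝ → ℝ} (hψ : IsLPProfile ψ) {k : ℤ}
    (hk : |(k : ℝ)| ≤ 1) : lpSymbol ψ 0 k = 1 := by
  have h : ∀ i : ℕ, ψ (|(k : ℝ)| / 2 ^ (i + 1)) = 0 := fun i => by
    refine hψ.eq_zero _ (by positivity) fun h => ?_
    have h1 : |(k : ℝ)| / 2 ^ (i + 1) ≤ 1 / 2 := by
      refine div_le_div₀ zero_le_one hk (by norm_num) ?_
      rw [pow_succ]
      have := one_le_pow₀ (one_le_two (α := ℝ)) (n := i)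
      linarith
    linarith [h.1]
  simp [lpSymbol, h]

theorem IsLPProfile.lpSymbol_eq_zero {ψ : ℝ → ℝ} (hψ : IsLPProfile ψ) {j : ℕ} {k : ℤ}
    (hk : 2 ^ (j + 1) ≤ |(k : ℝ)|) : lpSymbol ψ j k = 0 := by
  rw [lpSymbol]
  split_ifs with h
  · subst h
    rw [(hψ.hasSum_one _ (by simpa using hk)).tsum_eq, sub_self]
  · refine hψ.eq_zero _ (by positivity) fun h => ?_
    have h2 : (2 : ℝ) ≤ |(k : ℝ)| / 2 ^ j := by
      rw [le_div_iff₀ (by positivity), ← pow_succ']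
      exact hk
    linarith [h.2]

theorem IsLPProfile.norm_lpSymbol_le {ψ : ℝ → ℝ} (hψ : IsLPProfile ψ) (j : ℕ) (k : ℤ) :
    ‖(lpSymbol ψ j k : ℂ)‖ ≤ 1 := by
  rw [Complex.norm_real]
  rcases eq_or_ne j 0 with rfl | hj
  · by_cases hk : |k| ≤ 1
    · rw [hψ.lpSymbol_zero_of_abs_le (by exact_mod_cast hk), norm_one]
    · rw [hψ.lpSymbol_eq_zero (by
        rw [zero_add, pow_one]
        exact_mod_cast not_le.1 hk), norm_zero]
      exact zero_le_one
  · have h0 : (0 : ℝ) ≤ |(k : ℝ)| / 2 ^ j := by positivity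
    rw [lpSymbol, if_neg hj, Real.norm_of_nonneg (hψ.nonneg _ h0)]
    exact hψ.le_one h0

theorem l4LinfNormLE_propagator_lpBlock {α : ℝ} (h0 : 0 < α) (h1 : α < 1) {ψ : ℝ → ℝ}
    (hψ : IsLPProfile ψ) (u : L2Torus) (j : ℕ) :
    L4LinfNormLE (fun t => propagator α t (lpBlock ψ j u))
      (strichartzConst α * 2 ^ (1 / 2 - α / 4) * ‖u‖ * ((2 : ℝ) ^ j) ^ (1 / 2 - α / 4)) := by
  have hm := hψ.norm_lpSymbol_le j
  refine (l4LinfNormLE_propagator h0 h1 (R := 2 ^ (j + 1)) Nat.one_le_two_pow ?_).mono ?_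
  · intro k hk
    rw [lpBlock, fourierCoeff_fourierMul hm, hψ.lpSymbol_eq_zero, Complex.ofReal_zero, zero_mul]
    rw [Finset.mem_Ioo, ← abs_lt, not_lt] at hk
    exact_mod_cast hk
  · push_cast
    rw [pow_succ', Real.mul_rpow (by norm_num) (by positivity)]
    have h2 := norm_fourierMul_le hm u
    have h3 := strichartzConst_pos h0 h1
    rw [lpBlock]
    calc _ ≤ strichartzConst α * ((2 : ℝ) ^ (1 / 2 - α / 4) * ((2 : ℝ) ^ j) ^ (1 / 2 - α / 4)) *
          ‖u‖ := by gcongr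
      _ = _ := by ring

/-- The sharp projection to the frequencies `2 ^ i ≤ |k| < 2 ^ (i + 1)`, or `|k| < 2` if `i = 0`. -/
noncomputable def dyadicProj (i : ℕ) (u : L2Torus) : L2Torus :=
  fourierMul (fun k => if Nat.log 2 k.natAbs = i then 1 else 0) u

theorem fourierCoeff_dyadicProj (i : ℕ) (u : L2Torus) (k : ℤ) :
    fourierCoeff (dyadicProj i u) k =
      if Nat.log 2 k.natAbs = i then fourierCoeff u k else 0 := by
  rw [dyadicProj, fourierCoeff_fourierMul (B := 1) fun k => by split_ifs <;> simp]
  split_ifs <;> simp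

theorem norm_dyadicProj_le {γ : ℝ} (hγ : 0 ≤ γ) {u : L2Torus} (hu : MemSobolev γ u) (i : ℕ) :
    ‖dyadicProj i u‖ ≤ ((2 : ℝ) ^ i) ^ (-γ) * sobolevNorm γ u := by
  rw [sobolevNorm]
  refine le_of_sq_le_sq ?_ (by positivity)
  rw [mul_pow, Real.sq_sqrt (tsum_nonneg fun k => by positivity)]
  refine hasSum_le (fun k => ?_) (hasSum_norm_sq_fourierCoeff _) (hu.hasSum.mul_left _)
  rw [fourierCoeff_dyadicProj, ← mul_assoc]
  split_ifs with h
  · refine le_mul_of_one_le_left (by positivity) ?_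
    have h1 : ((2 : ℝ) ^ i) ^ 2 ≤ 1 + (k : ℝ) ^ 2 := by
      rcases eq_or_ne k 0 with rfl | hk
      · simp only [Int.natAbs_zero, Nat.log_zero_right] at h
        simp [← h]
      · have h2 : (2 : ℝ) ^ i ≤ |(k : ℝ)| := by
          have h3 := Nat.pow_log_le_self 2 (Int.natAbs_ne_zero.2 hk)
          rw [h] at h3
          rw [← Int.cast_abs, Int.abs_eq_natAbs, Int.cast_natCast]
          exact_mod_cast h3
        have h4 := pow_le_pow_left₀ (by positivity) h2 2
        rw [sq_abs] at h4
        linarith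
    have h5 := Real.rpow_le_rpow (by positivity) h1 hγ
    rw [Real.rpow_neg (by positivity), inv_pow, ← div_eq_inv_mul, le_div_iff₀ (by positivity),
      one_mul]
    refine le_trans (le_of_eq ?_) h5
    rw [← Real.rpow_mul_natCast (by positivity), mul_comm, Real.rpow_natCast_mul (by positivity)]
  · rw [norm_zero, zero_pow two_ne_zero]
    positivity

theorem hasSum_propagator_dyadicProj (α t : ℝ) (u : L2Torus) :
    HasSum (fun i => propagator α t (dyadicProj i u)) (propagator α t u) := by
  have h := (hasSum_fourierMul (fun k : ℤ => (norm_exp_neg_I_mul t (|(k : ℝ)| ^ α)).le) u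
    ).tsum_fiberwise (fun k : ℤ => Nat.log 2 k.natAbs)
  convert! h using 2 with i
  rw [tsum_subtype ((fun k : ℤ => Nat.log 2 k.natAbs) ⁻¹' {i}) fun k : ℤ =>
    (Complex.exp (-(Complex.I * t * (|(k : ℝ)| ^ α : ℝ))) * fourierCoeff u k) •
      (fourierLp 2 k : L2Torus), propagator, fourierMul]
  refine tsum_congr fun k => ?_
  rw [fourierCoeff_dyadicProj, indicator]
  simp only [mem_preimage, mem_singleton_iff]
  split_ifs <;> simp

/-- The inclusion of `L^∞(𝕋)` in `L²(𝕋)`. -/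
noncomputable def linfInclusion : LinfTorus →+ L2Torus :=
  AddSubgroup.inclusion (Lp.antitone le_top)

theorem continuous_linfInclusion : Continuous linfInclusion := by
  refine AddMonoidHomClass.continuous_of_bound linfInclusion 1 fun f => ?_
  rw [one_mul, Lp.norm_def, Lp.norm_def]
  refine ENNReal.toReal_mono (Lp.eLpNorm_ne_top f) ?_
  exact eLpNorm_le_eLpNorm_of_exponent_le le_top (Lp.aestronglyMeasurable f)

theorem hasSum_l4LinfNormLE {f : ℕ → ℝ → L2Torus} {g : ℝ → L2Torus} {M : ℕ → ℝ} {S : ℝ}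
    (hf : ∀ i, L4LinfNormLE (f i) (M i)) (hM : HasSum M S)
    (hg : ∀ t, HasSum (fun i => f i t) (g t)) : L4LinfNormLE g S := by
  have : Fact ((1 : ℝ≥0∞) ≤ 4) := ⟨by norm_num⟩
  choose F hF hFM using hf
  have hs : Summable fun i => ‖F i‖ :=
    Summable.of_nonneg_of_le (fun i => norm_nonneg _) hFM hM.summable
  refine ⟨∑' i, F i, ?_, tsum_of_norm_bounded hM hFM⟩
  filter_upwards [ae_all_iff.2 hF, Lp.hasSum_coeFn_tsum (tsum_enorm_ne_top_iff_summable_norm.2 hs)]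
    with t ht ht'
  have h1 := ht'.map linfInclusion continuous_linfInclusion
  have h2 : linfInclusion ((∑' i, F i : L4Linf) t) = g t := by
    refine h1.unique ?_
    convert! hg t using 2 with i
    exact Lp.ext (ht i)
  rw [← h2]
  rfl

theorem exists_l4LinfNormLE_sobolevNorm {α : ℝ} (h0 : 0 < α) (h1 : α < 1) {γ : ℝ}
    (hγ : 1 / 2 - α / 4 < γ) :
    ∃ C : ℝ, 0 < C ∧ ∀ u : L2Torus, MemSobolev γ u →
      L4LinfNormLE (fun t => propagator α t u) (C * sobolevNorm γ u) := by
  set e := 1 / 2 - α / 4 with he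
  set r : ℝ := 2 ^ (e - γ) with hr
  have hr0 : 0 < r := by positivity
  have hr1 : r < 1 := Real.rpow_lt_one_of_one_lt_of_neg one_lt_two (by linarith)
  have hC := strichartzConst_pos h0 h1
  have hr2 : 0 < (1 - r)⁻¹ := inv_pos.2 (by linarith)
  refine ⟨strichartzConst α * 2 ^ e * (1 - r)⁻¹, by positivity, fun u hu => ?_⟩
  have hsum : HasSum (fun i : ℕ => strichartzConst α * 2 ^ e * r ^ i * sobolevNorm γ u)
      (strichartzConst α * 2 ^ e * (1 - r)⁻¹ * sobolevNorm γ u) :=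
    ((hasSum_geometric_of_lt_one hr0.le hr1).mul_left _).mul_right _
  refine hasSum_l4LinfNormLE (fun i => ?_) hsum fun t => hasSum_propagator_dyadicProj α t u
  refine (l4LinfNormLE_propagator h0 h1 (R := 2 ^ (i + 1)) Nat.one_le_two_pow ?_).mono ?_
  · intro k hk
    rw [fourierCoeff_dyadicProj, if_neg]
    rintro rfl
    apply hk
    have := Nat.lt_pow_succ_log_self one_lt_two k.natAbs
    rw [Finset.mem_Ioo, ← abs_lt, Int.abs_eq_natAbs]
    exact_mod_cast this
  · have h2 := norm_dyadicProj_le (by linarith) hu i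
    have h3 : ((2 ^ (i + 1) : ℕ) : ℝ) ^ e * ((2 : ℝ) ^ i) ^ (-γ) = 2 ^ e * r ^ i := by
      push_cast
      rw [pow_succ', Real.mul_rpow (by norm_num) (by positivity), mul_assoc,
        ← Real.rpow_add (by positivity), hr, ← Real.rpow_mul_natCast (by norm_num), mul_comm _ (i : ℝ),
        Real.rpow_natCast_mul (by norm_num), sub_eq_add_neg]
    calc _ ≤ strichartzConst α * ((2 ^ (i + 1) : ℕ) : ℝ) ^ e *
          (((2 : ℝ) ^ i) ^ (-γ) * sobolevNorm γ u) := by gcongr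
      _ = strichartzConst α * (((2 ^ (i + 1) : ℕ) : ℝ) ^ e * ((2 : ℝ) ^ i) ^ (-γ)) *
          sobolevNorm γ u := by ring
      _ = _ := by
          rw [h3]
          ring

end TorusStrichartz

theorem mainTheorem5 (α : ℝ) (hα : 2 / 3 < α) (hα' : α < 1) :
    (∃ C : ℝ, 0 < C ∧ ∀ ψ : ℝ → ℝ, TorusStrichartz.IsLPProfile ψ →
      ∀ (u : TorusStrichartz.L2Torus) (j : ℕ),
        TorusStrichartz.L4LinfNormLE
          (fun t => TorusStrichartz.propagator α t (TorusStrichartz.lpBlock ψ j u))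
          (C * ‖u‖ * ((2 : ℝ) ^ j) ^ (1 / 2 - α / 4))) ∧
    (∀ γ : ℝ, 1 / 2 - α / 4 < γ →
      ∃ C : ℝ, 0 < C ∧ ∀ u : TorusStrichartz.L2Torus, TorusStrichartz.MemSobolev γ u →
        TorusStrichartz.L4LinfNormLE (fun t => TorusStrichartz.propagator α t u)
          (C * TorusStrichartz.sobolevNorm γ u)) := by
  have h0 : 0 < α := by linarith
  have hC := TorusStrichartz.strichartzConst_pos h0 hα'
  exact ⟨⟨_, by positivity, fun ψ hψ u j =>
    TorusStrichartz.l4LinfNormLE_propagator_lpBlock h0 hα' hψ u j⟩,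
    fun γ hγ => TorusStrichartz.exists_l4LinfNormLE_sobolevNorm h0 hα' hγ⟩
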